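/- **Setting.** There are $n$ base arms $1,\dots,n$; base arm $e$ has an unknown $R$-sub-Gaussian reward distribution with mean $w(e)$, i.e. $\mathbb{E}[e^{s(X-\mathbb{E}X)}]\le e^{R^2s^2/2}$ for all real $s$. A decision class $\mathcal{M}$ is a nonempty collection of nonempty subsets of $[n]$ (super arms). Let $\mathtt{MinW}(M,\boldsymbol{w})=\min_{e\in M}w(e)$, $\mathtt{OPT}=\max_{M\in\mathcal{M}}\mathtt{MinW}(M,\boldsymbol{w})$, let $M_*\in\mathcal{M}$ attain this maximum, and let $N=\{e\notin M_*: w(e)<\mathtt{OPT}\}$. The gaps are $\Delta^{C}_e=w(e)-\max_{M\in\mathcal{M},\,M\ne M_*}\mathtt{MinW}(M,\boldsymbol{w})$ for $e\in M_*$ and $\Delta^{C}_e=\mathtt{OPT}-\max_{M\in\mathcal{M}:\,e\in M}\mathtt{MinW}(M,\boldsymbol{w})$ for $e\in N$. A (possibly randomized) algorithm at each timestep, on the basis of its internal randomness and its past plays and observed rewards, either stops and returns a set of base arms, or plays one base arm and observes an independent sample of its reward. For given $n$, $\mathcal{M}$ and $R$, it is $(\delta,\varepsilon)$-correct if, for all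 $R$-sub-Gaussian reward distributions of the $n$ base arms, with probability at least $1-\delta$ it stops and returns a super arm $M\in\mathcal{M}$ with $\mathtt{MinW}(M,\boldsymbol{w})\ge\mathtt{OPT}-\varepsilon$. **The family.** For $R>0$ and $\varepsilon>0$, let $\mathcal{F}_{R,\varepsilon}$ be the family of all instances ($n$, $\mathcal{M}$, $\boldsymbol{w}$) with reward distributions $\mathcal{N}(w(e),R^2)$ such that 1. some $M_{\mathrm{second}}\in\mathcal{M}\setminus\{M_*\}$ maximizing $\mathtt{MinW}(\cdot,\boldsymbol{w})$ over $\mathcal{M}\setminus\{M_*\}$ is disjoint from $M_*$ and satisfies $\mathtt{MinW}(M_{\mathrm{second}},\boldsymbol{w})+\varepsilon<\mathtt{MinW}(M_*,\boldsymbol{w})$ (in particular $M_*$ is unique); 2. every $e\in N$ belongs to some super arm $M\in\mathcal{M}$ with $w(e')>\mathtt{OPT}+\varepsilon$ for all $e'\in M\setminus\{e\}$. **Theorem (Fixed-confidence Lower Bound for PAC).** For all $R>0$ and $\varepsilon>0$ the family $\mathcal{F}_{R,\varepsilon}$ contains instances with $n$ base arms for every $n\ge2$. There is a universal constant $c>0$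 such that for all $R>0$, $\varepsilon>0$, every instance in $\mathcal{F}_{R,\varepsilon}$, every $\delta\in(0,0.1)$ and every $(\delta,\varepsilon)$-correct algorithm (for the $n$, $\mathcal{M}$, $R$ of the instance), the expected number of samples $T$ that the algorithm uses on this instance satisfies $$\mathbb{E}[T]\;\ge\; c\sum_{e\in M_*\cup N}\frac{R^2}{\max\{(\Delta^{C}_e)^2,\varepsilon^2\}}\,\ln\frac1\delta .$$ -/

import Mathlib

open MeasureTheory ProbabilityTheory
open scoped NNReal ENNReal

namespace CPEB

noncomputable section

/-- A decision class over the base arms `Fin n`: a nonempty collection of super arms, each being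
a nonempty set of base arms. -/
structure DecisionClass (n : ℕ) where
  superArms : Finset (Finset (Fin n))
  nonempty : superArms.Nonempty
  superArm_nonempty : ∀ M ∈ superArms, M.Nonempty

/-- The bottleneck value `MinW(M, w) = min_{e ∈ M} w e` of a (nonempty) set of base arms. -/
def minW {n : ℕ} (M : Finset (Fin n)) (w : Fin n → ℝ) : ℝ :=
  sInf (w '' (M : Set (Fin n)))

/-- The optimal value `OPT = max_{M ∈ 𝓜} MinW(M, w)`. -/
def opt {n : ℕ} (D : DecisionClass n) (w : Fin n → ℝ) : ℝ :=
  sSup ((fun M => minW M w) '' {M | M ∈ D.superArms})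

/-- `max_{M ≠ Mstar} MinW(M, w)`, the maximum being over the super arms. -/
def secondValue {n : ℕ} (D : DecisionClass n) (w : Fin n → ℝ) (Mstar : Finset (Fin n)) : ℝ :=
  sSup ((fun M => minW M w) '' {M | M ∈ D.superArms ∧ M ≠ Mstar})

/-- `max_{M ∈ 𝓜 : e ∈ M} MinW(M, w)`. -/
def valueThrough {n : ℕ} (D : DecisionClass n) (w : Fin n → ℝ) (e : Fin n) : ℝ :=
  sSup ((fun M => minW M w) '' {M | M ∈ D.superArms ∧ e ∈ M})

/-- The fixed-confidence gap `Δ^C_e`, relative to the optimal super arm `Mstar`. -/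
def gap {n : ℕ} (D : DecisionClass n) (w : Fin n → ℝ) (Mstar : Finset (Fin n)) (e : Fin n) : ℝ :=
  if e ∈ Mstar then w e - secondValue D w Mstar
  else if opt D w ≤ w e then w e - valueThrough D w e
  else opt D w - valueThrough D w e

/-- The necessary base arms `N = {e | e ∉ Mstar, w e < OPT}`. -/
def necessaryArms {n : ℕ} (D : DecisionClass n) (w : Fin n → ℝ) (Mstar : Finset (Fin n)) :
    Finset (Fin n) :=
  Finset.univ.filter fun e => e ∉ Mstar ∧ w e < opt D w

/-- The reward distribution `ν` has an `R`-sub-Gaussian tail: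
`𝔼[exp (s (X - 𝔼 X))] ≤ exp (R² s² / 2)` for all real `s`. -/
def IsSubGaussian (R : ℝ≥0) (ν : Measure ℝ) : Prop :=
  HasSubgaussianMGF (fun x => x - ∫ y, y ∂ν) (R ^ 2) ν

/-- A (possibly randomized) sequential algorithm on the base arms `Fin n`, with internal random
seed in `S`. What the learner knows after `t` samples is the seed and the list of the `t` pairs
(played base arm, observed reward). On this basis `out` says whether the algorithm stops, and with
which answer (`none` means: do not stop), and `pick` says which base arm is played next if it
does not stop. -/
structure Algorithm (n : ℕ) (S : Type*) [MeasurableSpace S] where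
  seedLaw : Measure S
  seed_prob : IsProbabilityMeasure seedLaw
  pick : (t : ℕ) → S × (Fin t → Fin n × ℝ) → Fin n
  out : (t : ℕ) → S × (Fin t → Fin n × ℝ) → Option (Finset (Fin n))
  measurable_pick : ∀ t a, MeasurableSet {h | pick t h = a}
  measurable_out : ∀ t o, MeasurableSet {h | out t h = o}

namespace Algorithm

variable {n : ℕ} {S : Type*} [MeasurableSpace S]

/-- The first `t` plays and observations, for a seed `u` and a table `X` of rewards, where `X t e`
is the reward that base arm `e` yields if it is the arm played at the timestep following `t`
samples. (Past the stopping time this is a fictitious continuation.) -/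
def history (A : Algorithm n S) (u : S) (X : ℕ → Fin n → ℝ) : (t : ℕ) → (Fin t → Fin n × ℝ)
  | 0 => Fin.elim0
  | t + 1 =>
    let p := A.pick t (u, history A u X t)
    Fin.snoc (α := fun _ => Fin n × ℝ) (history A u X t) (p, X t p)

/-- The decision (stop with an answer, or go on) after `t` samples. -/
def decision (A : Algorithm n S) (ω : S × (ℕ → Fin n → ℝ)) (t : ℕ) :
    Option (Finset (Fin n)) :=
  A.out t (ω.1, A.history ω.1 ω.2 t)

/-- The number of samples used before stopping; `∞` if the algorithm never stops. -/
def numSamples (A : Algorithm n S) (ω : S × (ℕ → Fin n → ℝ)) : ℝ≥0∞ :=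
  ⨅ (t : ℕ) (_ : A.decision ω t ≠ none), (t : ℝ≥0∞)

/-- The algorithm stops, and its answer is `M`. -/
def Returns (A : Algorithm n S) (ω : S × (ℕ → Fin n → ℝ)) (M : Finset (Fin n)) : Prop :=
  ∃ t, A.decision ω t = some M ∧ ∀ s < t, A.decision ω s = none

/-- The joint law of seed and rewards when base arm `e` has reward distribution `ν e`:
all rewards are independent of each other and of the seed. -/
def law (A : Algorithm n S) (ν : Fin n → Measure ℝ) [∀ e, IsProbabilityMeasure (ν e)] :
    Measure (S × (ℕ → Fin n → ℝ)) :=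
  A.seedLaw.prod (Measure.infinitePi fun _ : ℕ => Measure.pi ν)

/-- The expected sample complexity. -/
def expectedSamples (A : Algorithm n S) (ν : Fin n → Measure ℝ)
    [∀ e, IsProbabilityMeasure (ν e)] : ℝ≥0∞ :=
  ∫⁻ ω, A.numSamples ω ∂(A.law ν)

/-- `(δ, ε)`-correctness for the decision class `D` and sub-Gaussian parameter `R`: whatever the
`R`-sub-Gaussian reward distributions are, with probability at least `1 - δ` the algorithm returns
a super arm whose bottleneck value is at least `OPT - ε`. -/
def IsCorrect (A : Algorithm n S) (D : DecisionClass n) (R : ℝ≥0) (δ ε : ℝ) : Prop :=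
  ∀ (ν : Fin n → Measure ℝ) [∀ e, IsProbabilityMeasure (ν e)],
    (∀ e, IsSubGaussian R (ν e)) →
      ENNReal.ofReal (1 - δ) ≤
        A.law ν {ω | ∃ M ∈ D.superArms, A.Returns ω M ∧
          opt D (fun e => ∫ x, x ∂(ν e)) - ε ≤ minW M (fun e => ∫ x, x ∂(ν e))}

end Algorithm

/-- The reward distributions `N(w e, R²)`. -/
abbrev gaussianArms {n : ℕ} (w : Fin n → ℝ) (R : ℝ≥0) : Fin n → Measure ℝ :=
  fun e => gaussianReal (w e) (R ^ 2)

/-- The family of hard instances for accuracy `ε`: `Mstar` is an optimal super arm; some second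
best super arm `Msec` shares no base arm with `Mstar` and is worse than `Mstar` by more than `ε`
(so `Mstar` is the only super arm of value at least `OPT - ε`); and every necessary base arm
belongs to a super arm in which all the other base arms have expected reward above `OPT + ε`. -/
structure IsHard {n : ℕ} (D : DecisionClass n) (ε : ℝ) (w : Fin n → ℝ)
    (Mstar : Finset (Fin n)) : Prop where
  optimal : Mstar ∈ D.superArms ∧ ∀ M ∈ D.superArms, minW M w ≤ minW Mstar w
  second : ∃ Msec ∈ D.superArms, Msec ≠ Mstar ∧
    (∀ M ∈ D.superArms, M ≠ Mstar → minW M w ≤ minW Msec w) ∧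
    Disjoint Msec Mstar ∧ minW Msec w + ε < minW Mstar w
  single : ∀ e ∈ necessaryArms D w Mstar, ∃ M ∈ D.superArms, e ∈ M ∧
    ∀ a ∈ M, a ≠ e → opt D w + ε < w a

end

end CPEB

/-! ### Change of measure along histories -/

namespace CPEB

namespace Algorithm

section History

variable {n : ℕ} {S : Type*} [MeasurableSpace S]

/-! On a hard instance `Mstar` is the only `ε`-optimal super arm, so a correct algorithm returns it
with probability at least `1 - δ`. For each `e` in `Mstar ∪ N` the mean of `e` alone can be shifted
by some `d` with `|d| = Δ + 2ε < 3Δ`, `Δ > ε` being the gap of `e`, so that `Mstar` is no longer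
`ε`-optimal and is returned with probability at most `δ` (`IsHard.exists_shift`). Distinguishing the
two instances must cost order `(R/Δ)² log (1/δ)` samples of `e`. Each sample is charged to one arm,
so these bounds add up to a bound on the total.

The cost estimate uses the shifts by `d` and by `-d` together. Their likelihood ratios with respect
to the original instance multiply to `exp (-T d² / R²)`, where `T` is the number of plays of `e`:
the noise cancels. If `T` is small the product is not small, and by AM-GM a weighted sum of the two
ratios is at least 1. Integrating over the event that `Mstar` is returned after few plays of `e`
bounds its probability by those of the answer `Mstar` under the two shifts
(`measure_returns_inter_le`), with no concentration inequality. Markov's inequality handles the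
event of many plays. -/

theorem history_congr (A : Algorithm n S) (u : S) {X Y : ℕ → Fin n → ℝ} (t : ℕ)
    (h : ∀ s < t, X s = Y s) : A.history u X t = A.history u Y t := by
  induction t with
  | zero => rfl
  | succ t ih =>
    simp only [history, ih fun s hs => h s (by omega), h t (by omega)]

theorem history_castLE (A : Algorithm n S) (u : S) (X : ℕ → Fin n → ℝ) {s t : ℕ} (hst : s ≤ t) :
    (fun i : Fin s => A.history u X t (Fin.castLE hst i)) = A.history u X s := by
  induction t, hst using Nat.le_induction with
  | base => rfl
  | succ t hst ih =>
    rw [← ih]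
    funext i
    exact Fin.snoc_castSucc (α := fun _ => Fin n × ℝ) _ _ (Fin.castLE hst i)

theorem history_succ_last (A : Algorithm n S) (u : S) (X : ℕ → Fin n → ℝ) (t : ℕ) :
    A.history u X (t + 1) (Fin.last t) =
      (A.pick t (u, A.history u X t), X t (A.pick t (u, A.history u X t))) :=
  Fin.snoc_last (α := fun _ => Fin n × ℝ) _ _

theorem history_apply_fst (A : Algorithm n S) (u : S) (X : ℕ → Fin n → ℝ) {t : ℕ} (i : Fin t) :
    (A.history u X t i).1 = A.pick i (u, A.history u X i) := by
  have h := congrFun (A.history_castLE u X (Nat.succ_le_of_lt i.2)) (Fin.last i)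
  rw [history_succ_last] at h
  exact congrArg Prod.fst h

theorem measurable_pick' (A : Algorithm n S) (t : ℕ) : Measurable (A.pick t) :=
  measurable_to_countable' fun a => A.measurable_pick t a

/-- One step of the interaction: the history after one more play, for the reward vector `x`. -/
def extend (A : Algorithm n S) (u : S) (t : ℕ) (h : Fin t → Fin n × ℝ) (x : Fin n → ℝ) :
    Fin (t + 1) → Fin n × ℝ :=
  Fin.snoc (α := fun _ => Fin n × ℝ) h (A.pick t (u, h), x (A.pick t (u, h)))

theorem measurable_eval_pick (A : Algorithm n S) (t : ℕ) :
    Measurable fun q : (S × (Fin t → Fin n × ℝ)) × (Fin n → ℝ) => q.2 (A.pick t q.1) := by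
  have h : Measurable fun r : Fin n × (Fin n → ℝ) => r.2 r.1 :=
    measurable_from_prod_countable_right fun a => measurable_pi_apply a
  exact h.comp (((A.measurable_pick' t).comp measurable_fst).prodMk measurable_snd)

theorem measurable_extend (A : Algorithm n S) (t : ℕ) :
    Measurable fun q : (S × (Fin t → Fin n × ℝ)) × (Fin n → ℝ) =>
      A.extend q.1.1 t q.1.2 q.2 := by
  refine measurable_pi_lambda _ fun i => ?_
  refine Fin.lastCases ?_ (fun j => ?_) i
  · simp only [extend, Fin.snoc_last]
    exact ((A.measurable_pick' t).comp measurable_fst).prodMk (A.measurable_eval_pick t)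
  · simp only [extend, Fin.snoc_castSucc]
    fun_prop

theorem measurable_history (A : Algorithm n S) (t : ℕ) :
    Measurable fun ω : S × (ℕ → Fin n → ℝ) => A.history ω.1 ω.2 t := by
  induction t with
  | zero => exact measurable_pi_lambda _ fun i => i.elim0
  | succ t ih =>
    exact (A.measurable_extend t).comp ((measurable_fst.prodMk ih).prodMk (by fun_prop))

theorem measurable_history_right (A : Algorithm n S) (u : S) (t : ℕ) :
    Measurable fun X : ℕ → Fin n → ℝ => A.history u X t :=
  (A.measurable_history t).comp (measurable_const.prodMk measurable_id)

/-- The history after `t` samples reads only the rows before row `t`, and the rows are independent.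
-/
theorem indepFun_history (A : Algorithm n S) (u : S) (t : ℕ) (P : Measure (Fin n → ℝ))
    [IsProbabilityMeasure P] :
    IndepFun (fun X : ℕ → Fin n → ℝ => A.history u X t) (fun X => X t)
      (Measure.infinitePi fun _ : ℕ => P) := by
  have h := (iIndepFun_infinitePi (P := fun _ : ℕ => P) (X := fun _ x => x)
    fun _ => measurable_id).indepFun_finset (Finset.range t) {t} (by simp) (by fun_prop)
  -- The first `t` rows are padded with zeros to a full table; by `history_congr` the padding does
  -- not affect the history.
  have hφ : Measurable fun (Y : Finset.range t → Fin n → ℝ) (s : ℕ) =>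
      if hs : s ∈ Finset.range t then Y ⟨s, hs⟩ else 0 := by
    refine measurable_pi_lambda _ fun s => ?_
    by_cases hs : s ∈ Finset.range t
    · simp only [hs, dif_pos]
      exact measurable_pi_apply _
    · simp only [hs, dif_neg, not_false_eq_true]
      exact measurable_const
  have h' := h.comp ((A.measurable_history_right u t).comp hφ)
    (measurable_pi_apply (⟨t, Finset.mem_singleton_self t⟩ : ({t} : Finset ℕ)))
  refine IndepFun.congr h' (Filter.Eventually.of_forall fun X => ?_)
    (Filter.Eventually.of_forall fun X => rfl)
  refine A.history_congr u t fun s hs => ?_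
  simp [hs]

theorem lintegral_history_succ (A : Algorithm n S) (u : S) (t : ℕ) (P : Measure (Fin n → ℝ))
    [IsProbabilityMeasure P] {g : (Fin t → Fin n × ℝ) → (Fin n → ℝ) → ℝ≥0∞}
    (hg : Measurable (Function.uncurry g)) :
    ∫⁻ X, g (A.history u X t) (X t) ∂(Measure.infinitePi fun _ : ℕ => P) =
      ∫⁻ X, ∫⁻ x, g (A.history u X t) x ∂P ∂(Measure.infinitePi fun _ : ℕ => P) := by
  have hm := A.measurable_history_right u t
  have hmap := (A.indepFun_history u t P).map_prod_eq_prod_map_map hm.aemeasurable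
    (measurable_pi_apply t).aemeasurable
  rw [Measure.infinitePi_map_eval] at hmap
  calc _ = ∫⁻ q, Function.uncurry g q ∂((Measure.infinitePi fun _ : ℕ => P).map
          fun X => (A.history u X t, X t)) := by
        rw [lintegral_map hg (hm.prodMk (measurable_pi_apply t))]; rfl
    _ = _ := by
        rw [hmap, lintegral_prod _ hg.aemeasurable, lintegral_map _ hm]
        · rfl
        · exact hg.lintegral_prod_right'

/-- The likelihood ratio of a history, for the likelihood ratios `r a` of the base arms. -/
noncomputable def likelihood {t : ℕ} (r : Fin n → ℝ → ℝ≥0∞) (h : Fin t → Fin n × ℝ) : ℝ≥0∞ :=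
  ∏ i, r (h i).1 (h i).2

theorem measurable_uncurry_ratio {r : Fin n → ℝ → ℝ≥0∞} (hr : ∀ a, Measurable (r a)) :
    Measurable fun y : Fin n × ℝ => r y.1 y.2 :=
  measurable_from_prod_countable_right fun a => hr a

theorem measurable_likelihood {t : ℕ} {r : Fin n → ℝ → ℝ≥0∞} (hr : ∀ a, Measurable (r a)) :
    Measurable (likelihood (t := t) r) :=
  Finset.measurable_prod _ fun i _ =>
    (measurable_uncurry_ratio hr).comp (measurable_pi_apply i)

theorem likelihood_extend (A : Algorithm n S) (u : S) {t : ℕ} (r : Fin n → ℝ → ℝ≥0∞)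
    (h : Fin t → Fin n × ℝ) (x : Fin n → ℝ) :
    likelihood r (A.extend u t h x) =
      likelihood r h * r (A.pick t (u, h)) (x (A.pick t (u, h))) := by
  simp [likelihood, extend, Fin.prod_univ_castSucc]

theorem lintegral_pi_eval_withDensity (ν ν' : Fin n → Measure ℝ) [∀ e, IsProbabilityMeasure (ν e)]
    [∀ e, IsProbabilityMeasure (ν' e)] {r : Fin n → ℝ → ℝ≥0∞} (hr : ∀ a, Measurable (r a))
    (hν : ∀ a, ν' a = (ν a).withDensity (r a)) (a : Fin n) {f : ℝ → ℝ≥0∞} (hf : Measurable f) :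
    ∫⁻ x, f (x a) ∂(Measure.pi ν') = ∫⁻ x, f (x a) * r a (x a) ∂(Measure.pi ν) := by
  rw [(measurePreserving_eval ν' a).lintegral_comp hf,
    (measurePreserving_eval ν a).lintegral_comp (f := fun y => f y * r a y) (hf.mul (hr a)), hν a,
    lintegral_withDensity_eq_lintegral_mul _ (hr a) hf]
  simp only [Pi.mul_apply, mul_comm]

/-- Induction on the length: given the past, the next arm is fixed and only its reward is read, so
changing the law of the last row costs one factor `r`. The induction hypothesis then changes the law
of the past. Since the interaction continues fictitiously after stopping, the length `t` is
deterministic. -/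
theorem lintegral_history_change (A : Algorithm n S) (u : S) (ν ν' : Fin n → Measure ℝ)
    [∀ e, IsProbabilityMeasure (ν e)] [∀ e, IsProbabilityMeasure (ν' e)]
    {r : Fin n → ℝ → ℝ≥0∞} (hr : ∀ a, Measurable (r a))
    (hν : ∀ a, ν' a = (ν a).withDensity (r a)) (t : ℕ)
    {f : (Fin t → Fin n × ℝ) → ℝ≥0∞} (hf : Measurable f) :
    ∫⁻ X, f (A.history u X t) ∂(Measure.infinitePi fun _ : ℕ => Measure.pi ν') =
      ∫⁻ X, f (A.history u X t) * likelihood r (A.history u X t)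
        ∂(Measure.infinitePi fun _ : ℕ => Measure.pi ν) := by
  induction t with
  | zero => simp [history, likelihood]
  | succ t ih =>
    have hE : Measurable fun q : (Fin t → Fin n × ℝ) × (Fin n → ℝ) => A.extend u t q.1 q.2 :=
      (A.measurable_extend t).comp (f := fun q : (Fin t → Fin n × ℝ) × (Fin n → ℝ) => ((u, q.1), q.2)) (by fun_prop)
    have hp : Measurable fun q : (Fin t → Fin n × ℝ) × (Fin n → ℝ) => q.2 (A.pick t (u, q.1)) :=
      (A.measurable_eval_pick t).comp (f := fun q : (Fin t → Fin n × ℝ) × (Fin n → ℝ) => ((u, q.1), q.2)) (by fun_prop)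
    have hp' : Measurable fun q : (Fin t → Fin n × ℝ) × (Fin n → ℝ) => A.pick t (u, q.1) :=
      (A.measurable_pick' t).comp
        (f := fun q : (Fin t → Fin n × ℝ) × (Fin n → ℝ) => (u, q.1)) (by fun_prop)
    have hR : Measurable fun q : (Fin t → Fin n × ℝ) × (Fin n → ℝ) =>
        f (A.extend u t q.1 q.2) * r (A.pick t (u, q.1)) (q.2 (A.pick t (u, q.1))) :=
      (hf.comp hE).mul ((measurable_uncurry_ratio hr).comp (hp'.prodMk hp))
    calc _ = ∫⁻ X, ∫⁻ x, f (A.extend u t (A.history u X t) x) ∂(Measure.pi ν')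
          ∂(Measure.infinitePi fun _ : ℕ => Measure.pi ν') :=
          A.lintegral_history_succ u t _ (g := fun h x => f (A.extend u t h x)) (hf.comp hE)
      _ = ∫⁻ X, ∫⁻ x, f (A.extend u t (A.history u X t) x) *
            r (A.pick t (u, A.history u X t)) (x (A.pick t (u, A.history u X t)))
            ∂(Measure.pi ν) ∂(Measure.infinitePi fun _ : ℕ => Measure.pi ν') := by
          refine lintegral_congr fun X => ?_
          refine lintegral_pi_eval_withDensity ν ν' hr hν (A.pick t (u, A.history u X t))
            (f := fun y => f (Fin.snoc (α := fun _ => Fin n × ℝ) (A.history u X t)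
              (A.pick t (u, A.history u X t), y))) (hf.comp ?_)
          refine measurable_pi_lambda _ fun i => ?_
          refine Fin.lastCases ?_ (fun j => ?_) i
          · simp only [Fin.snoc_last]
            fun_prop
          · simp only [Fin.snoc_castSucc]
            fun_prop
      _ = _ := by
          rw [ih (f := fun h => ∫⁻ x, f (A.extend u t h x) *
            r (A.pick t (u, h)) (x (A.pick t (u, h))) ∂(Measure.pi ν)) hR.lintegral_prod_right']
          refine Eq.trans ?_ (A.lintegral_history_succ u t _
            (g := fun h x => f (A.extend u t h x) * likelihood r (A.extend u t h x))
            ((hf.mul (measurable_likelihood hr)).comp hE)).symm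
          refine lintegral_congr fun X => ?_
          refine (lintegral_mul_const _ (hR.comp (by fun_prop : Measurable fun x : Fin n → ℝ =>
            (A.history u X t, x)))).symm.trans ?_
          refine lintegral_congr fun x => ?_
          rw [likelihood_extend, Function.comp_apply, mul_assoc, mul_comm (r _ _)]

theorem lintegral_law_change (A : Algorithm n S) (ν ν' : Fin n → Measure ℝ)
    [∀ e, IsProbabilityMeasure (ν e)] [∀ e, IsProbabilityMeasure (ν' e)]
    {r : Fin n → ℝ → ℝ≥0∞} (hr : ∀ a, Measurable (r a))
    (hν : ∀ a, ν' a = (ν a).withDensity (r a)) (t : ℕ)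
    {f : S × (Fin t → Fin n × ℝ) → ℝ≥0∞} (hf : Measurable f) :
    ∫⁻ ω, f (ω.1, A.history ω.1 ω.2 t) ∂(A.law ν') =
      ∫⁻ ω, f (ω.1, A.history ω.1 ω.2 t) * likelihood r (A.history ω.1 ω.2 t) ∂(A.law ν) := by
  have hh := A.measurable_history t
  have hm : Measurable fun ω : S × (ℕ → Fin n → ℝ) => f (ω.1, A.history ω.1 ω.2 t) :=
    hf.comp (measurable_fst.prodMk hh)
  have hm' : Measurable fun ω : S × (ℕ → Fin n → ℝ) =>
      f (ω.1, A.history ω.1 ω.2 t) * likelihood r (A.history ω.1 ω.2 t) :=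
    hm.mul ((measurable_likelihood hr).comp hh)
  rw [law, law, lintegral_prod _ hm.aemeasurable, lintegral_prod _ hm'.aemeasurable]
  exact lintegral_congr fun u =>
    A.lintegral_history_change u ν ν' hr hν t (f := fun h => f (u, h)) (hf.comp (by fun_prop))

end History

end Algorithm

end CPEB

namespace CPEB

namespace Algorithm

/-! ### The answer returned, and change of measure at the stopping time -/

section Returns

variable {n : ℕ} {S : Type*} [MeasurableSpace S]

instance (A : Algorithm n S) (ν : Fin n → Measure ℝ) [∀ e, IsProbabilityMeasure (ν e)] :
    IsProbabilityMeasure (A.law ν) := by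
  have := A.seed_prob
  unfold law
  infer_instance

theorem measurableSet_decision (A : Algorithm n S) (t : ℕ) (o : Option (Finset (Fin n))) :
    MeasurableSet {ω | A.decision ω t = o} :=
  (measurable_fst.prodMk (A.measurable_history t)) (A.measurable_out t o)

/-- The event that the algorithm stops after exactly `k` samples, with answer `M`. -/
def returnsAt (A : Algorithm n S) (M : Finset (Fin n)) (k : ℕ) :
    Set (S × (ℕ → Fin n → ℝ)) :=
  {ω | A.decision ω k = some M ∧ ∀ s < k, A.decision ω s = none}

theorem measurableSet_returnsAt (A : Algorithm n S) (M : Finset (Fin n)) (k : ℕ) :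
    MeasurableSet (A.returnsAt M k) := by
  have h : A.returnsAt M k =
      {ω | A.decision ω k = some M} ∩ ⋂ s, ⋂ _ : s < k, {ω | A.decision ω s = none} := by
    ext ω; simp [returnsAt]
  rw [h]
  exact (A.measurableSet_decision k _).inter
    (.iInter fun s => .iInter fun _ => A.measurableSet_decision s _)

theorem setOf_returns (A : Algorithm n S) (M : Finset (Fin n)) :
    {ω | A.Returns ω M} = ⋃ k, A.returnsAt M k := by
  ext ω; simp [Returns, returnsAt]

theorem measurableSet_returns (A : Algorithm n S) (M : Finset (Fin n)) :
    MeasurableSet {ω | A.Returns ω M} := by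
  rw [setOf_returns]
  exact .iUnion fun k => A.measurableSet_returnsAt M k

theorem eq_of_mem_returnsAt (A : Algorithm n S) {M M' : Finset (Fin n)} {k k' : ℕ}
    {ω : S × (ℕ → Fin n → ℝ)} (h : ω ∈ A.returnsAt M k) (h' : ω ∈ A.returnsAt M' k') :
    k = k' := by
  rcases lt_trichotomy k k' with hlt | heq | hlt
  · have := h'.2 k hlt
    simp [h.1] at this
  · exact heq
  · have := h.2 k' hlt
    simp [h'.1] at this

theorem Returns.unique {A : Algorithm n S} {ω : S × (ℕ → Fin n → ℝ)} {M M' : Finset (Fin n)}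
    (h : A.Returns ω M) (h' : A.Returns ω M') : M = M' := by
  obtain ⟨k, hk⟩ := h
  obtain ⟨k', hk'⟩ := h'
  obtain rfl := A.eq_of_mem_returnsAt (M := M) (M' := M') hk hk'
  exact Option.some_injective _ (hk.1.symm.trans hk'.1)

theorem measure_returns (A : Algorithm n S) (M : Finset (Fin n))
    (μ : Measure (S × (ℕ → Fin n → ℝ))) :
    μ {ω | A.Returns ω M} = ∑' k, μ (A.returnsAt M k) := by
  rw [setOf_returns]
  refine measure_iUnion (fun k k' hk => ?_) fun k => A.measurableSet_returnsAt M k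
  exact Set.disjoint_left.2 fun ω h h' => hk (A.eq_of_mem_returnsAt h h')

/-- The event `returnsAt M k` in terms of the seed and the history after `k` samples. -/
def stopSet (A : Algorithm n S) (M : Finset (Fin n)) (k : ℕ) :
    Set (S × (Fin k → Fin n × ℝ)) :=
  {q | A.out k q = some M ∧
    ∀ s, ∀ hs : s < k, A.out s (q.1, fun i : Fin s => q.2 (Fin.castLE hs.le i)) = none}

theorem measurableSet_stopSet (A : Algorithm n S) (M : Finset (Fin n)) (k : ℕ) :
    MeasurableSet (A.stopSet M k) := by
  have h : A.stopSet M k = {q | A.out k q = some M} ∩ ⋂ s, ⋂ hs : s < k,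
      (fun q : S × (Fin k → Fin n × ℝ) => (q.1, fun i : Fin s => q.2 (Fin.castLE hs.le i))) ⁻¹'
        {q | A.out s q = none} := by
    ext ω; simp [stopSet]
  rw [h]
  refine (A.measurable_out k _).inter (.iInter fun s => .iInter fun hs => ?_)
  exact (by fun_prop : Measurable fun q : S × (Fin k → Fin n × ℝ) =>
    (q.1, fun i : Fin s => q.2 (Fin.castLE hs.le i))) (A.measurable_out s none)

/-- Earlier decisions depend on prefixes of the history at time `k`, so the stopping event is a
function of the seed and that history, as the change of measure at fixed length requires. -/
theorem mem_stopSet_history (A : Algorithm n S) (M : Finset (Fin n)) (k : ℕ)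
    (ω : S × (ℕ → Fin n → ℝ)) :
    (ω.1, A.history ω.1 ω.2 k) ∈ A.stopSet M k ↔ ω ∈ A.returnsAt M k := by
  refine and_congr Iff.rfl (forall_congr' fun s => forall_congr' fun hs => ?_)
  simp only [decision, A.history_castLE ω.1 ω.2 hs.le]

theorem measure_returnsAt_change (A : Algorithm n S) (ν ν' : Fin n → Measure ℝ)
    [∀ e, IsProbabilityMeasure (ν e)] [∀ e, IsProbabilityMeasure (ν' e)]
    {r : Fin n → ℝ → ℝ≥0∞} (hr : ∀ a, Measurable (r a))
    (hν : ∀ a, ν' a = (ν a).withDensity (r a)) (M : Finset (Fin n)) (k : ℕ) :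
    A.law ν' (A.returnsAt M k) =
      ∫⁻ ω in A.returnsAt M k, likelihood r (A.history ω.1 ω.2 k) ∂(A.law ν) := by
  have h := A.lintegral_law_change ν ν' hr hν k (f := (A.stopSet M k).indicator fun _ => 1)
    (measurable_const.indicator (A.measurableSet_stopSet M k))
  have h1 : ∀ ω : S × (ℕ → Fin n → ℝ), (A.stopSet M k).indicator (fun _ => (1 : ℝ≥0∞))
      (ω.1, A.history ω.1 ω.2 k) = (A.returnsAt M k).indicator 1 ω := fun ω => by
    by_cases hω : ω ∈ A.returnsAt M k
    · rw [Set.indicator_of_mem ((A.mem_stopSet_history M k ω).2 hω), Set.indicator_of_mem hω]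
      rfl
    · rw [Set.indicator_of_notMem (mt (A.mem_stopSet_history M k ω).1 hω),
        Set.indicator_of_notMem hω]
  simp_rw [h1] at h
  rw [← lintegral_indicator_one (A.measurableSet_returnsAt M k),
    ← lintegral_indicator (A.measurableSet_returnsAt M k), h]
  refine lintegral_congr fun ω => ?_
  by_cases hω : ω ∈ A.returnsAt M k <;> simp [hω]

/-- Two-sided change of measure on the event that `M` is returned. -/
theorem measure_returns_inter_le (A : Algorithm n S) (ν ν₁ ν₂ : Fin n → Measure ℝ)
    [∀ e, IsProbabilityMeasure (ν e)] [∀ e, IsProbabilityMeasure (ν₁ e)]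
    [∀ e, IsProbabilityMeasure (ν₂ e)] {r₁ r₂ : Fin n → ℝ → ℝ≥0∞}
    (hr₁ : ∀ a, Measurable (r₁ a)) (hr₂ : ∀ a, Measurable (r₂ a))
    (hν₁ : ∀ a, ν₁ a = (ν a).withDensity (r₁ a)) (hν₂ : ∀ a, ν₂ a = (ν a).withDensity (r₂ a))
    (M : Finset (Fin n)) {G : Set (S × (ℕ → Fin n → ℝ))} (hG : MeasurableSet G) (a b : ℝ≥0∞)
    (h : ∀ k, ∀ ω ∈ A.returnsAt M k ∩ G, 1 ≤ a * likelihood r₁ (A.history ω.1 ω.2 k) +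
      b * likelihood r₂ (A.history ω.1 ω.2 k)) :
    A.law ν ({ω | A.Returns ω M} ∩ G) ≤
      a * A.law ν₁ {ω | A.Returns ω M} + b * A.law ν₂ {ω | A.Returns ω M} := by
  have hstep : ∀ k, A.law ν (A.returnsAt M k ∩ G) ≤
      a * A.law ν₁ (A.returnsAt M k) + b * A.law ν₂ (A.returnsAt M k) := fun k => by
    have hm₁ : Measurable fun ω : S × (ℕ → Fin n → ℝ) =>
        likelihood r₁ (A.history ω.1 ω.2 k) :=
      (measurable_likelihood hr₁).comp (A.measurable_history k)
    have hm₂ : Measurable fun ω : S × (ℕ → Fin n → ℝ) =>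
        likelihood r₂ (A.history ω.1 ω.2 k) :=
      (measurable_likelihood hr₂).comp (A.measurable_history k)
    rw [A.measure_returnsAt_change ν ν₁ hr₁ hν₁, A.measure_returnsAt_change ν ν₂ hr₂ hν₂,
      ← lintegral_const_mul a hm₁, ← lintegral_const_mul b hm₂,
      ← lintegral_add_left (hm₁.const_mul a)]
    calc A.law ν (A.returnsAt M k ∩ G) = ∫⁻ _ in A.returnsAt M k ∩ G, 1 ∂(A.law ν) := by simp
      _ ≤ ∫⁻ ω in A.returnsAt M k ∩ G, (a * likelihood r₁ (A.history ω.1 ω.2 k) +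
            b * likelihood r₂ (A.history ω.1 ω.2 k)) ∂(A.law ν) :=
          setLIntegral_mono' ((A.measurableSet_returnsAt M k).inter hG) (h k)
      _ ≤ _ := lintegral_mono_set Set.inter_subset_left
  rw [A.measure_returns M (A.law ν₁), A.measure_returns M (A.law ν₂), setOf_returns,
    Set.iUnion_inter, ← ENNReal.tsum_mul_left, ← ENNReal.tsum_mul_left, ← ENNReal.tsum_add]
  exact (measure_iUnion_le _).trans (ENNReal.tsum_le_tsum hstep)

end Returns

/-! ### Counting the samples of each arm -/

section Counts

variable {n : ℕ} {S : Type*} [MeasurableSpace S]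

/-- The event that the algorithm does not stop within `s` samples and plays `e` next. -/
def playsAt (A : Algorithm n S) (e : Fin n) (s : ℕ) : Set (S × (ℕ → Fin n → ℝ)) :=
  {ω | (∀ r ≤ s, A.decision ω r = none) ∧ A.pick s (ω.1, A.history ω.1 ω.2 s) = e}

theorem measurableSet_playsAt (A : Algorithm n S) (e : Fin n) (s : ℕ) :
    MeasurableSet (A.playsAt e s) := by
  have h : A.playsAt e s = (⋂ r, ⋂ _ : r ≤ s, {ω | A.decision ω r = none}) ∩
      {ω | A.pick s (ω.1, A.history ω.1 ω.2 s) = e} := by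
    ext ω; simp [playsAt]
  rw [h]
  exact (MeasurableSet.iInter fun r => .iInter fun _ => A.measurableSet_decision r _).inter
    ((measurable_fst.prodMk (A.measurable_history s)) (A.measurable_pick s e))

/-- The number of samples of base arm `e` before stopping. -/
noncomputable def armSamples (A : Algorithm n S) (e : Fin n) (ω : S × (ℕ → Fin n → ℝ)) : ℝ≥0∞ :=
  ∑' s, (A.playsAt e s).indicator 1 ω

theorem measurable_armSamples (A : Algorithm n S) (e : Fin n) : Measurable (A.armSamples e) :=
  Measurable.tsum fun s => measurable_one.indicator (A.measurableSet_playsAt e s)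

/-- For any `t` at which the algorithm decides to stop, only the times before `t` contribute, and
each contributes to at most one arm. If there is no such `t`, the right side is `∞`. -/
theorem sum_armSamples_le (A : Algorithm n S) (F : Finset (Fin n)) (ω : S × (ℕ → Fin n → ℝ)) :
    ∑ e ∈ F, A.armSamples e ω ≤ A.numSamples ω := by
  refine le_iInf₂ fun t ht => ?_
  have h1 : ∀ e, A.armSamples e ω = ∑ s ∈ Finset.range t, (A.playsAt e s).indicator 1 ω := by
    refine fun e => tsum_eq_sum fun s hs => Set.indicator_of_notMem (fun hω => ht ?_) _
    exact hω.1 t (by simpa using hs)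
  simp only [h1]
  rw [Finset.sum_comm]
  calc _ ≤ ∑ s ∈ Finset.range t, (1 : ℝ≥0∞) := by
        refine Finset.sum_le_sum fun s _ => ?_
        calc _ ≤ ∑ e ∈ F, if A.pick s (ω.1, A.history ω.1 ω.2 s) = e then (1 : ℝ≥0∞) else 0 := by
              refine Finset.sum_le_sum fun e _ => ?_
              by_cases hω : ω ∈ A.playsAt e s
              · simp [hω, hω.2]
              · simp [hω]
          _ ≤ 1 := by
              rw [Finset.sum_ite_eq]
              split_ifs <;> simp
    _ = t := by simp

theorem sum_lintegral_armSamples_le (A : Algorithm n S) (F : Finset (Fin n)) (ν : Fin n → Measure ℝ)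
    [∀ e, IsProbabilityMeasure (ν e)] :
    ∑ e ∈ F, ∫⁻ ω, A.armSamples e ω ∂(A.law ν) ≤ A.expectedSamples ν := by
  rw [← lintegral_finsetSum _ fun e _ => A.measurable_armSamples e]
  exact lintegral_mono fun ω => A.sum_armSamples_le F ω

/-- The number of plays of `e` recorded in a history. -/
def playCount {t : ℕ} (e : Fin n) (h : Fin t → Fin n × ℝ) : ℕ :=
  (Finset.univ.filter fun i => (h i).1 = e).card

theorem playCount_le_armSamples (A : Algorithm n S) (e : Fin n) {M : Finset (Fin n)} {k : ℕ}
    {ω : S × (ℕ → Fin n → ℝ)} (hω : ω ∈ A.returnsAt M k) :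
    (playCount e (A.history ω.1 ω.2 k) : ℝ≥0∞) ≤ A.armSamples e ω := by
  refine le_trans (le_of_eq ?_) (ENNReal.sum_le_tsum (Finset.range k))
  rw [Finset.sum_range, playCount, Finset.card_filter, Nat.cast_sum]
  refine Finset.sum_congr rfl fun i _ => ?_
  have h : ω ∈ A.playsAt e i ↔ (A.history ω.1 ω.2 k i).1 = e := by
    rw [A.history_apply_fst]
    exact and_iff_right fun r hr => hω.2 r (by omega)
  by_cases hi : (A.history ω.1 ω.2 k i).1 = e
  · simp [hi, h.2 hi]
  · simp [hi, mt h.1 hi]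

end Counts

end Algorithm

/-! ### Gaussian likelihood ratios under opposite shifts -/

section Gaussian

/-- The likelihood ratio of `N(m + d, v)` to `N(m, v)`. -/
noncomputable def shiftRatio (v : ℝ≥0) (m d x : ℝ) : ℝ≥0∞ :=
  ENNReal.ofReal (Real.exp ((d * (x - m) - d ^ 2 / 2) / v))

theorem measurable_shiftRatio (v : ℝ≥0) (m d : ℝ) : Measurable (shiftRatio v m d) := by
  unfold shiftRatio
  fun_prop

theorem gaussianReal_add_eq_withDensity {v : ℝ≥0} (hv : v ≠ 0) (m d : ℝ) :
    gaussianReal (m + d) v = (gaussianReal m v).withDensity (shiftRatio v m d) := by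
  have hv' : (v : ℝ) ≠ 0 := by exact_mod_cast hv
  rw [gaussianReal_of_var_ne_zero _ hv, gaussianReal_of_var_ne_zero _ hv,
    ← withDensity_mul _ (measurable_gaussianPDF m v) (measurable_shiftRatio v m d)]
  congr 1
  funext x
  simp only [Pi.mul_apply, gaussianPDF, shiftRatio]
  rw [← ENNReal.ofReal_mul (gaussianPDFReal_nonneg _ _ _), gaussianPDFReal, gaussianPDFReal,
    mul_assoc _ (Real.exp _), ← Real.exp_add]
  congr 3
  field_simp
  ring

theorem isSubGaussian_gaussianReal (R : ℝ≥0) (m : ℝ) :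
    IsSubGaussian R (gaussianReal m (R ^ 2)) := by
  rw [IsSubGaussian, integral_id_gaussianReal]
  refine ⟨fun t => ?_, fun t => ?_⟩
  · have h := (integrable_exp_mul_gaussianReal (μ := m) (v := R ^ 2) t).mul_const
      (Real.exp (-(t * m)))
    refine h.congr (Filter.Eventually.of_forall fun x => ?_)
    simp only [← Real.exp_add]
    congr 1
    ring
  · rw [mgf_gaussianReal (μ := 0) (v := R ^ 2) (by
      simpa using gaussianReal_map_sub_const (μ := m) (v := R ^ 2) m)]
    simp

/-- The exponent terms linear in `x - m` cancel between the two shifts, leaving a constant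
independent of the observation. -/
theorem shiftRatio_mul_neg (v : ℝ≥0) (m d x : ℝ) :
    shiftRatio v m d x * shiftRatio v m (-d) x = ENNReal.ofReal (Real.exp (-(d ^ 2 / v))) := by
  rw [shiftRatio, shiftRatio, ← ENNReal.ofReal_mul (Real.exp_nonneg _), ← Real.exp_add]
  congr 2
  ring

/-- If `x y ≥ 1 / E`, then `1 ≤ x / (4 δ) + δ E y`. -/
theorem one_le_add_of_le_mul {δ E x y : ℝ} (hδ : 0 < δ) (hE : 0 < E) (hx : 0 ≤ x) (hy : 0 ≤ y)
    (h : 1 ≤ E * (x * y)) : 1 ≤ 1 / (4 * δ) * x + δ * E * y := by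
  have h1 : 0 ≤ 1 / (4 * δ) * x := by positivity
  have h2 : 0 ≤ δ * E * y := by positivity
  -- For the two summands `p`, `q` this gives `4 p q ≥ 1`, hence `(p + q)² = (p - q)² + 4 p q ≥ 1`.
  have h3 : 4 * ((1 / (4 * δ) * x) * (δ * E * y)) = E * (x * y) := by
    field_simp
  nlinarith [sq_nonneg (1 / (4 * δ) * x - δ * E * y)]

/-- The likelihood ratios of the base arms when the mean of base arm `e` is shifted by `d`. -/
noncomputable def armRatio {n : ℕ} (v : ℝ≥0) (w : Fin n → ℝ) (e : Fin n) (d : ℝ) (a : Fin n) :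
    ℝ → ℝ≥0∞ :=
  shiftRatio v (w a) ((Pi.single e d : Fin n → ℝ) a)

theorem likelihood_armRatio_ne_top {n t : ℕ} (v : ℝ≥0) (w : Fin n → ℝ) (e : Fin n) (d : ℝ)
    (h : Fin t → Fin n × ℝ) : Algorithm.likelihood (armRatio v w e d) h ≠ ∞ :=
  ENNReal.prod_ne_top fun _ _ => ENNReal.ofReal_ne_top

/-- Arms other than `e` are not shifted and contribute factors 1; each play of `e` contributes the
same constant. -/
theorem likelihood_armRatio_mul_neg {n t : ℕ} (v : ℝ≥0) (w : Fin n → ℝ) (e : Fin n) (d : ℝ)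
    (h : Fin t → Fin n × ℝ) :
    Algorithm.likelihood (armRatio v w e d) h * Algorithm.likelihood (armRatio v w e (-d)) h =
      ENNReal.ofReal (Real.exp (-(Algorithm.playCount e h * (d ^ 2 / v)))) := by
  rw [Algorithm.likelihood, Algorithm.likelihood, ← Finset.prod_mul_distrib]
  have h1 : ∀ i, armRatio v w e d (h i).1 (h i).2 * armRatio v w e (-d) (h i).1 (h i).2 =
      if (h i).1 = e then ENNReal.ofReal (Real.exp (-(d ^ 2 / v))) else 1 := fun i => by
    simp only [armRatio]
    split_ifs with hi
    · rw [hi, Pi.single_eq_same, Pi.single_eq_same, shiftRatio_mul_neg]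
    · rw [Pi.single_eq_of_ne hi, Pi.single_eq_of_ne hi]
      simp [shiftRatio]
  rw [Finset.prod_congr rfl fun i _ => h1 i, ← Finset.prod_filter, Finset.prod_const,
    ← ENNReal.ofReal_pow (Real.exp_nonneg _), ← Real.exp_nat_mul, Algorithm.playCount]
  congr 2
  ring

theorem one_le_likelihood_add {n t : ℕ} (v : ℝ≥0) (w : Fin n → ℝ) (e : Fin n) (d : ℝ)
    (h : Fin t → Fin n × ℝ) {δ L : ℝ} (hδ : 0 < δ)
    (hL : Algorithm.playCount e h * (d ^ 2 / v) ≤ L) :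
    1 ≤ ENNReal.ofReal (1 / (4 * δ)) *
        Algorithm.likelihood (armRatio v w e d) h +
      ENNReal.ofReal (δ * Real.exp L) *
        Algorithm.likelihood (armRatio v w e (-d)) h := by
  have hmul := likelihood_armRatio_mul_neg v w e d h
  have hx' := likelihood_armRatio_ne_top v w e d h
  have hy' := likelihood_armRatio_ne_top v w e (-d) h
  generalize Algorithm.likelihood (armRatio v w e d) h = x at *
  generalize Algorithm.likelihood (armRatio v w e (-d)) h = y at *
  lift x to ℝ≥0 using hx'
  lift y to ℝ≥0 using hy'
  have hxy : (x : ℝ) * y = Real.exp (-(Algorithm.playCount e h * (d ^ 2 / v))) := by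
    have := congrArg ENNReal.toReal hmul
    rwa [ENNReal.toReal_mul, ENNReal.toReal_ofReal (Real.exp_nonneg _)] at this
  have key : 1 ≤ 1 / (4 * δ) * (x : ℝ) + δ * Real.exp L * y := by
    refine one_le_add_of_le_mul hδ (Real.exp_pos L) x.2 y.2 ?_
    rw [hxy, ← Real.exp_add]
    exact Real.one_le_exp (by linarith)
  rw [← ENNReal.ofReal_coe_nnreal (p := x), ← ENNReal.ofReal_coe_nnreal (p := y),
    ← ENNReal.ofReal_mul (by positivity), ← ENNReal.ofReal_mul (by positivity),
    ← ENNReal.ofReal_add (by positivity) (by positivity), ← ENNReal.ofReal_one]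
  exact ENNReal.ofReal_le_ofReal key

end Gaussian

end CPEB

/-! ### Lower bound on the samples of a single arm -/

namespace CPEB

/-- If shifting the mean of the Gaussian base arm `e` by `d` makes `M` an unlikely answer, then the
original probability of the answer `M` with few samples of `e` is bounded. -/
theorem Algorithm.measure_returns_inter_armSamples_le {n : ℕ} {S : Type*} [MeasurableSpace S]
    (A : Algorithm n S) {R : ℝ≥0} (hR : 0 < R) (w : Fin n → ℝ) (e : Fin n) {d δ K L : ℝ}
    (hδ : 0 < δ) (hK : 0 ≤ K) (hKL : K * (d ^ 2 / (R : ℝ) ^ 2) ≤ L) (M : Finset (Fin n))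
    (h₁ : A.law (gaussianArms (w + Pi.single e d) R) {ω | A.Returns ω M} ≤ ENNReal.ofReal δ) :
    A.law (gaussianArms w R)
        ({ω | A.Returns ω M} ∩ {ω | A.armSamples e ω < ENNReal.ofReal K}) ≤
      ENNReal.ofReal (1 / 4 + δ * Real.exp L) := by
  have hv : R ^ 2 ≠ 0 := pow_ne_zero 2 hR.ne'
  have hmeas : ∀ (d : ℝ) (a : Fin n), Measurable (armRatio (R ^ 2) w e d a) := fun d a =>
    measurable_shiftRatio _ _ _
  have hdens : ∀ (d : ℝ) (a : Fin n), gaussianArms (w + Pi.single e d) R a =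
      (gaussianArms w R a).withDensity (armRatio (R ^ 2) w e d a) := fun d a =>
    gaussianReal_add_eq_withDensity hv (w a) ((Pi.single e d : Fin n → ℝ) a)
  have hpoint : ∀ k, ∀ ω ∈ A.returnsAt M k ∩ {ω | A.armSamples e ω < ENNReal.ofReal K},
      1 ≤ ENNReal.ofReal (1 / (4 * δ)) *
          likelihood (armRatio (R ^ 2) w e d) (A.history ω.1 ω.2 k) +
        ENNReal.ofReal (δ * Real.exp L) *
          likelihood (armRatio (R ^ 2) w e (-d)) (A.history ω.1 ω.2 k) := fun k ω hω => by
    refine one_le_likelihood_add (R ^ 2) w e d _ hδ (le_trans ?_ hKL)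
    have h := (A.playCount_le_armSamples e hω.1).trans hω.2.le
    rw [← ENNReal.ofReal_natCast, ENNReal.ofReal_le_ofReal_iff hK] at h
    rw [NNReal.coe_pow]
    exact mul_le_mul_of_nonneg_right h (by positivity)
  have hG : MeasurableSet {ω | A.armSamples e ω < ENNReal.ofReal K} :=
    measurableSet_lt (A.measurable_armSamples e) measurable_const
  have hmain := A.measure_returns_inter_le (gaussianArms w R) (gaussianArms (w + Pi.single e d) R)
    (gaussianArms (w + Pi.single e (-d)) R) (r₁ := armRatio (R ^ 2) w e d)
    (r₂ := armRatio (R ^ 2) w e (-d)) (hmeas d) (hmeas (-d))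
  have hdens₁ := hdens d
  replace hmain := hmain hdens₁ (hdens (-d)) M hG _ _ hpoint
  refine hmain.trans ?_
  rw [ENNReal.ofReal_add (by positivity) (by positivity)]
  -- The weight `1 / (4δ)` turns the bound `δ` into `1/4`. For the shift by `-d` the trivial bound 1
  -- suffices, so nothing about the algorithm's behaviour there is needed.
  refine add_le_add ((mul_le_mul_right h₁ _).trans_eq ?_)
    ((mul_le_mul_right prob_le_one _).trans_eq (mul_one _))
  rw [← ENNReal.ofReal_mul (by positivity)]
  congr 1
  field_simp

/-- The left side is `√δ`, and `(8/25)² = 0.1024 > 1/10`. -/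
theorem mul_exp_half_log_le {δ : ℝ} (hδ : 0 < δ) (hδ' : δ < 1 / 10) :
    δ * Real.exp (Real.log (1 / δ) / 2) ≤ 8 / 25 := by
  have h2 : Real.exp (Real.log (1 / δ) / 2) ^ 2 = 1 / δ := by
    rw [← Real.exp_nat_mul, Nat.cast_two, mul_div_cancel₀ _ two_ne_zero,
      Real.exp_log (by positivity)]
  have h3 : (δ * Real.exp (Real.log (1 / δ) / 2)) ^ 2 = δ := by
    rw [mul_pow, h2]; field_simp
  exact le_of_sq_le_sq (by rw [h3]; linarith) (by norm_num)

/-- If shifting the mean of the Gaussian base arm `e` by `d` makes an answer of probability at least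
`1 - δ` have probability at most `δ`, then `e` is sampled of order `(R / d)² log (1 / δ)` times. -/
theorem Algorithm.le_lintegral_armSamples {n : ℕ} {S : Type*} [MeasurableSpace S]
    (A : Algorithm n S) {R : ℝ≥0} (hR : 0 < R) (w : Fin n → ℝ) (e : Fin n) {d Δ δ : ℝ}
    (hΔ : 0 < Δ) (hd : |d| ≤ 3 * Δ) (hδ : 0 < δ) (hδ' : δ < 1 / 10) (M : Finset (Fin n))
    (h₀ : ENNReal.ofReal (1 - δ) ≤ A.law (gaussianArms w R) {ω | A.Returns ω M})
    (h₁ : A.law (gaussianArms (w + Pi.single e d) R) {ω | A.Returns ω M} ≤ ENNReal.ofReal δ) :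
    ENNReal.ofReal (1 / 72 * ((R : ℝ) ^ 2 / Δ ^ 2 * Real.log (1 / δ))) ≤
      ∫⁻ ω, A.armSamples e ω ∂(A.law (gaussianArms w R)) := by
  by_contra! hlt
  have hR' : (0 : ℝ) < R := hR
  have hlog : 0 < Real.log (1 / δ) := Real.log_pos (by rw [lt_div_iff₀ hδ]; linarith)
  -- The 18 makes `K d² / R² ≤ log (1/δ) / 2` when `d² ≤ 9 Δ²`. This `K` is four times the
  -- expectation bound assumed for contradiction, so Markov's inequality gives `1/4`.
  obtain ⟨K, hK⟩ : ∃ K, K = (R : ℝ) ^ 2 / Δ ^ 2 * Real.log (1 / δ) / 18 := ⟨_, rfl⟩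
  have hK0 : 0 < K := by rw [hK]; positivity
  have hKL : K * (d ^ 2 / (R : ℝ) ^ 2) ≤ Real.log (1 / δ) / 2 := by
    have hd2 : d ^ 2 ≤ 9 * Δ ^ 2 := by
      rw [← sq_abs]; nlinarith [abs_nonneg d]
    calc K * (d ^ 2 / (R : ℝ) ^ 2) ≤ K * (9 * Δ ^ 2 / (R : ℝ) ^ 2) := by gcongr
      _ = Real.log (1 / δ) / 2 := by rw [hK]; field_simp; norm_num
  have hGc : A.law (gaussianArms w R) {ω | ENNReal.ofReal K ≤ A.armSamples e ω} ≤
      ENNReal.ofReal (1 / 4) := by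
    refine (meas_ge_le_lintegral_div (A.measurable_armSamples e).aemeasurable
      (by simpa using hK0) ENNReal.ofReal_ne_top).trans
        ((ENNReal.div_le_div_right hlt.le _).trans ?_)
    rw [← ENNReal.ofReal_div_of_pos hK0]
    refine ENNReal.ofReal_le_ofReal (le_of_eq ?_)
    rw [div_eq_iff hK0.ne', hK]
    ring
  have hbound := A.measure_returns_inter_armSamples_le hR w e hδ hK0.le hKL M h₁
  have htot : ENNReal.ofReal (1 - δ) ≤
      ENNReal.ofReal (1 / 4 + δ * Real.exp (Real.log (1 / δ) / 2) + 1 / 4) := by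
    rw [ENNReal.ofReal_add (by positivity) (by norm_num)]
    refine (h₀.trans (measure_mono fun ω hω => ?_)).trans
      ((measure_union_le _ _).trans (add_le_add hbound hGc))
    exact (lt_or_ge (A.armSamples e ω) (ENNReal.ofReal K)).imp (fun h => ⟨hω, h⟩) id
  rw [ENNReal.ofReal_le_ofReal_iff (by positivity)] at htot
  -- The right side is at most `1/4 + 8/25 + 1/4 = 0.82`, while `1 - δ > 0.9`.
  linarith [mul_exp_half_log_le hδ hδ']

/-! ### Bottleneck values, shifted instances and correctness -/

section Values

variable {n : ℕ} {D : DecisionClass n} {w : Fin n → ℝ} {M Mstar : Finset (Fin n)} {e : Fin n}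

theorem minW_le (he : e ∈ M) : minW M w ≤ w e :=
  csInf_le (M.finite_toSet.image w).bddBelow ⟨e, he, rfl⟩

theorem lt_minW (hM : M.Nonempty) {b : ℝ} (h : ∀ a ∈ M, b < w a) : b < minW M w := by
  obtain ⟨a, ha, hw⟩ := (Set.Nonempty.image w hM).csInf_mem (M.finite_toSet.image w)
  exact (h a ha).trans_eq hw

theorem minW_congr {w' : Fin n → ℝ} (h : ∀ a ∈ M, w a = w' a) : minW M w = minW M w' := by
  rw [minW, minW]
  exact congrArg sInf (Set.image_congr h)

theorem minW_le_opt (hM : M ∈ D.superArms) : minW M w ≤ opt D w :=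
  le_csSup (D.superArms.finite_toSet.image _).bddAbove ⟨M, hM, rfl⟩

variable {ε : ℝ}

namespace IsHard

theorem opt_eq (h : IsHard D ε w Mstar) : opt D w = minW Mstar w :=
  IsGreatest.csSup_eq ⟨⟨Mstar, h.optimal.1, rfl⟩, by rintro _ ⟨M, hM, rfl⟩; exact h.optimal.2 M hM⟩

theorem minW_add_lt (h : IsHard D ε w Mstar) (hM : M ∈ D.superArms) (hne : M ≠ Mstar) :
    minW M w + ε < opt D w := by
  obtain ⟨Msec, -, -, h1, -, h2⟩ := h.second
  rw [h.opt_eq]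
  linarith [h1 M hM hne]

theorem exists_second (h : IsHard D ε w Mstar) : ∃ Msec ∈ D.superArms, Disjoint Msec Mstar ∧
    secondValue D w Mstar = minW Msec w ∧ minW Msec w + ε < minW Mstar w := by
  obtain ⟨Msec, hm, hne, h1, h2, h3⟩ := h.second
  refine ⟨Msec, hm, h2, IsGreatest.csSup_eq ⟨⟨Msec, ⟨hm, hne⟩, rfl⟩, ?_⟩, h3⟩
  rintro _ ⟨M, hM, rfl⟩
  exact h1 M hM.1 hM.2

/-- For every base arm that matters there is a shift of its mean, comparable with its gap, after
which `Mstar` is not `ε`-optimal any more. -/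
theorem exists_shift (h : IsHard D ε w Mstar) (hε : 0 < ε)
    (he : e ∈ Mstar ∪ necessaryArms D w Mstar) :
    ε < gap D w Mstar e ∧ ∃ d, |d| = gap D w Mstar e + 2 * ε ∧
      minW Mstar (w + Pi.single e d) < opt D (w + Pi.single e d) - ε := by
  by_cases hs : e ∈ Mstar
  · obtain ⟨Msec, hm, hdis, hval, hlt⟩ := h.exists_second
    have hg : gap D w Mstar e = w e - minW Msec w := by rw [gap, if_pos hs, hval]
    have hw := minW_le (w := w) hs
    -- Lowering `e` this far puts `Mstar` at least `2ε` below `Msec`, whose value is unchanged by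
    -- disjointness.
    refine ⟨by linarith, -(gap D w Mstar e + 2 * ε), ?_, ?_⟩
    · rw [abs_neg, abs_of_pos (by linarith)]
    · set d := -(gap D w Mstar e + 2 * ε) with hd
      have h1 : minW Mstar (w + Pi.single e d) ≤ w e + d := by
        refine (minW_le hs).trans_eq ?_
        simp
      have h2 : minW Msec (w + Pi.single e d) = minW Msec w := minW_congr fun a ha => by
        have : a ≠ e := fun hae => Finset.disjoint_left.1 hdis ha (hae ▸ hs)
        simp [this]
      have h3 := minW_le_opt (w := w + Pi.single e d) hm
      linarith
  · have hN : e ∈ necessaryArms D w Mstar := (Finset.mem_union.1 he).resolve_left hs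
    have hlt : w e < opt D w := by simpa [necessaryArms, hs] using hN
    obtain ⟨M, hM, heM, hMw⟩ := h.single e hN
    have hg : gap D w Mstar e = opt D w - valueThrough D w e := by
      rw [gap, if_neg hs, if_neg hlt.not_ge]
    have hne : ((fun M => minW M w) '' {M | M ∈ D.superArms ∧ e ∈ M}).Nonempty :=
      ⟨_, M, ⟨hM, heM⟩, rfl⟩
    have hv1 : valueThrough D w e ≤ w e := by
      refine csSup_le hne ?_
      rintro _ ⟨M', hM', rfl⟩
      exact minW_le hM'.2
    -- The best super arm through `e` is not `Mstar`, as `e ∉ Mstar`, so it is worse than the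
    -- optimum by more than `ε`.
    have hv2 : valueThrough D w e + ε < opt D w := by
      have hmem := hne.csSup_mem ((D.superArms.finite_toSet.subset fun M hM => hM.1).image _)
      obtain ⟨M', hM', hval⟩ := hmem
      have h4 := h.minW_add_lt hM'.1 fun hc => hs (hc ▸ hM'.2)
      have hval' : minW M' w = valueThrough D w e := hval
      linarith
    refine ⟨by linarith, gap D w Mstar e + 2 * ε, abs_of_pos (by linarith), ?_⟩
    set d := gap D w Mstar e + 2 * ε with hd
    have h1 : minW Mstar (w + Pi.single e d) = minW Mstar w := minW_congr fun a ha => by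
      have : a ≠ e := fun hae => hs (hae ▸ ha)
      simp [this]
    -- The raised mean of `e` is at least `OPT + 2ε` because `valueThrough D w e ≤ w e`; the other
    -- arms of `M` exceed `OPT + ε` by hypothesis.
    have h2 : opt D w + ε < minW M (w + Pi.single e d) := by
      refine lt_minW ⟨e, heM⟩ fun a ha => ?_
      by_cases hae : a = e
      · subst hae
        simp only [Pi.add_apply, Pi.single_eq_same]
        linarith
      · simpa [hae] using hMw a ha hae
    have h3 := minW_le_opt (w := w + Pi.single e d) hM
    have h4 := h.opt_eq
    linarith

end IsHard

theorem Algorithm.IsCorrect.gaussian {S : Type*} [MeasurableSpace S] {A : Algorithm n S} {R : ℝ≥0}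
    {δ : ℝ} (hA : A.IsCorrect D R δ ε) (w : Fin n → ℝ) :
    ENNReal.ofReal (1 - δ) ≤ A.law (gaussianArms w R)
      {ω | ∃ M ∈ D.superArms, A.Returns ω M ∧ opt D w - ε ≤ minW M w} := by
  simpa only [gaussianArms, integral_id_gaussianReal] using
    hA (gaussianArms w R) fun e => isSubGaussian_gaussianReal R (w e)

/-- Answers are unique, so returning a bad `M` excludes the success event, whose probability is at
least `1 - δ`. -/
theorem Algorithm.IsCorrect.measure_returns_le {S : Type*} [MeasurableSpace S]
    {A : Algorithm n S} {R : ℝ≥0} {δ : ℝ} (hA : A.IsCorrect D R δ ε) (hδ : 0 ≤ δ) (hδ' : δ ≤ 1)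
    {w : Fin n → ℝ} (hM : minW M w < opt D w - ε) :
    A.law (gaussianArms w R) {ω | A.Returns ω M} ≤ ENNReal.ofReal δ := by
  have h := hA.gaussian w
  have h2 : A.law (gaussianArms w R)
      {ω | ∃ M ∈ D.superArms, A.Returns ω M ∧ opt D w - ε ≤ minW M w} ≤
      A.law (gaussianArms w R) {ω | A.Returns ω M}ᶜ := by
    refine measure_mono ?_
    rintro ω ⟨M', -, hr, hle⟩ hω
    rw [hr.unique hω] at hle
    linarith
  have h3 := prob_add_prob_compl (μ := A.law (gaussianArms w R)) (A.measurableSet_returns M)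
  have h4 := add_le_add_right (h.trans h2) (A.law (gaussianArms w R) {ω | A.Returns ω M})
  rw [h3] at h4
  have h5 : ENNReal.ofReal δ + ENNReal.ofReal (1 - δ) = 1 := by
    rw [← ENNReal.ofReal_add hδ (by linarith)]; simp
  rw [← h5] at h4
  exact (ENNReal.add_le_add_iff_right ENNReal.ofReal_ne_top).1 h4

theorem IsHard.le_lintegral_armSamples {S : Type*} [MeasurableSpace S]
    {A : Algorithm n S} {R : ℝ≥0} {δ : ℝ} (h : IsHard D ε w Mstar) (hε : 0 < ε) (hR : 0 < R)
    (hδ : 0 < δ) (hδ' : δ < 1 / 10) (hA : A.IsCorrect D R δ ε)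
    (he : e ∈ Mstar ∪ necessaryArms D w Mstar) :
    ENNReal.ofReal (1 / 72 * ((R : ℝ) ^ 2 / max (gap D w Mstar e ^ 2) (ε ^ 2) *
      Real.log (1 / δ))) ≤ ∫⁻ ω, A.armSamples e ω ∂(A.law (gaussianArms w R)) := by
  obtain ⟨hgap, d, hd, hlt⟩ := h.exists_shift hε he
  -- Since the gap exceeds `ε`, the maximum is the squared gap, and the shift `gap + 2ε` is below
  -- three gaps.
  rw [max_eq_left (by gcongr)]
  refine A.le_lintegral_armSamples hR w e (hε.trans hgap) (by linarith) hδ hδ' Mstar ?_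
    (hA.measure_returns_le hδ.le (by linarith) hlt)
  refine (hA.gaussian w).trans (measure_mono ?_)
  rintro ω ⟨M, hM, hr, hle⟩
  by_cases hne : M = Mstar
  · exact hne ▸ hr
  · linarith [h.minW_add_lt hM hne]

end Values

/-! ### Hard instances exist -/

theorem minW_singleton {n : ℕ} (e : Fin n) (w : Fin n → ℝ) : minW {e} w = w e := by
  simp [minW]

/-- The decision class of all singletons. -/
def singletonClass (n : ℕ) (hn : 0 < n) : DecisionClass n where
  superArms := Finset.univ.image fun e => {e}
  nonempty := ⟨{⟨0, hn⟩}, Finset.mem_image_of_mem _ (Finset.mem_univ _)⟩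
  superArm_nonempty := by simp

theorem exists_isHard (n : ℕ) (hn : 2 ≤ n) (ε : ℝ) (hε : 0 < ε) :
    ∃ (D : DecisionClass n) (w : Fin n → ℝ) (Mstar : Finset (Fin n)), IsHard D ε w Mstar := by
  have hmem : ∀ e, {e} ∈ (singletonClass n (by omega)).superArms := fun e =>
    Finset.mem_image_of_mem _ (Finset.mem_univ e)
  have h01 : (⟨1, hn⟩ : Fin n) ≠ ⟨0, by omega⟩ := by simp
  -- One arm has mean `2ε` and all others mean 0, so the best and second-best values differ by more
  -- than `ε`. The condition on necessary arms is vacuous for singletons: `{e}` has no other arms.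
  refine ⟨singletonClass n (by omega), Pi.single ⟨0, by omega⟩ (2 * ε), {⟨0, by omega⟩},
    ⟨hmem _, fun M hM => ?_⟩, ⟨{⟨1, hn⟩}, hmem _, fun hc => h01 (Finset.singleton_injective hc), fun M hM hne => ?_,
      Finset.disjoint_singleton.2 h01, ?_⟩,
    fun e _ => ⟨{e}, hmem e, by simp, fun a ha hae => absurd (Finset.mem_singleton.1 ha) hae⟩⟩
  · obtain ⟨a, -, rfl⟩ := Finset.mem_image.1 hM
    rw [minW_singleton, minW_singleton, Pi.single_eq_same, Pi.single_apply]
    split_ifs <;> linarith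
  · obtain ⟨a, -, rfl⟩ := Finset.mem_image.1 hM
    have ha : a ≠ ⟨0, by omega⟩ := fun hc => hne (by rw [hc])
    rw [minW_singleton, minW_singleton, Pi.single_eq_of_ne ha, Pi.single_eq_of_ne h01]
  · rw [minW_singleton, minW_singleton, Pi.single_eq_of_ne h01, Pi.single_eq_same]
    linarith

end CPEB

theorem mainTheorem7 :
    (∀ (n : ℕ), 2 ≤ n → ∀ (ε : ℝ), 0 < ε →
      ∃ (D : CPEB.DecisionClass n) (w : Fin n → ℝ) (Mstar : Finset (Fin n)),
        CPEB.IsHard D ε w Mstar) ∧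
    ∃ c : ℝ, 0 < c ∧
      ∀ (n : ℕ) (D : CPEB.DecisionClass n) (R : ℝ≥0) (ε : ℝ) (w : Fin n → ℝ)
        (Mstar : Finset (Fin n)), 0 < R → 0 < ε → CPEB.IsHard D ε w Mstar →
      ∀ (δ : ℝ), 0 < δ → δ < 0.1 →
      ∀ (S : Type*) [MeasurableSpace S] (A : CPEB.Algorithm n S), A.IsCorrect D R δ ε →
        ENNReal.ofReal (c * ∑ e ∈ Mstar ∪ CPEB.necessaryArms D w Mstar,
            (R : ℝ) ^ 2 / max (CPEB.gap D w Mstar e ^ 2) (ε ^ 2) * Real.log (1 / δ)) ≤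
          A.expectedSamples (CPEB.gaussianArms w R) := by
  refine ⟨CPEB.exists_isHard, 1 / 72, by norm_num, ?_⟩
  intro n D R ε w Mstar hR hε h δ hδ hδ' S _ A hA
  have hlog : 0 ≤ Real.log (1 / δ) := Real.log_nonneg (by rw [le_div_iff₀ hδ]; linarith)
  have hδ'' : δ < 1 / 10 := by norm_num at hδ' ⊢; exact hδ'
  rw [Finset.mul_sum, ENNReal.ofReal_sum_of_nonneg fun e _ => by positivity]
  exact (Finset.sum_le_sum fun e he => h.le_lintegral_armSamples hε hR hδ hδ'' hA he).trans
    (A.sum_lintegral_armSamples_le _ _)
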